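/- **Setting.** Let $R$ be a commutative $\mathbb C$-algebra with $\mathbb C$-linear derivations $\partial_{t^{(1)}_p},\partial_{t^{(2)}_p}$ $(p\ge 1)$; for example, an algebra of functions or of formal power series in the times $\mathbf t=(t^{(1)}_p,t^{(2)}_p)_{p\ge1}$ with the partial derivatives. Functions $f(s)$ are maps $\mathbb Z\to R$ (so $f=f(s,\mathbf t)$), $\Lambda(f)(s)=f(s+1)$, and formal difference operators $\sum_i a_i(s)\Lambda^i$, with degrees $i$ bounded above (Laurent series in $\Lambda^{-1}$) or bounded below (Laurent series in $\Lambda$), are multiplied by $\Lambda\cdot f=\Lambda(f)\cdot\Lambda$. Derivations act on operators coefficientwise. Write $(\sum_i a_i\Lambda^i)_{\ge0}=\sum_{i\ge0}a_i\Lambda^i$, $(\sum_i a_i\Lambda^i)_{<0}=\sum_{i<0}a_i\Lambda^i$, and $(\sum_i a_i\Lambda^i)^*=\sum_i\Lambda^{-i}a_i$. A *Toda Lax pair* is a pair $$L_1=S_1\Lambda S_1^{-1},\qquad L_2=S_2\Lambda^{-1}S_2^{-1},$$ with $S_1=1+\sum_{i\ge1}f_i\Lambda^{-i}$ inverted as a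 Laurent series in $\Lambda^{-1}$ and $S_2=g_0+\sum_{i\ge1}g_i\Lambda^{i}$ ($g_0$ invertible) inverted as a Laurent series in $\Lambda$, which satisfies the Toda Lax equations: for all $p\ge1$ and $i=1,2$, $$\partial_{t^{(1)}_p}L_i=[(L_1^p)_{\ge0},L_i],\qquad \partial_{t^{(2)}_p}L_i=[(L_2^p)_{<0},L_i].$$ A function $q$ is a *Toda eigenfunction* if $\partial_{t^{(1)}_p}q=(L_1^p)_{\ge0}(q)$ and $\partial_{t^{(2)}_p}q=(L_2^p)_{<0}(q)$ for all $p\ge1$. A function $r$ is an *adjoint Toda eigenfunction* if $\partial_{t^{(1)}_p}r=-((L_1^p)_{\ge0})^*(r)$ and $\partial_{t^{(2)}_p}r=-((L_2^p)_{<0})^*(r)$ for all $p\ge1$. Put $\Delta=\Lambda-1$, $\iota_{\Lambda^+}\Delta^{-1}=-\sum_{i\ge0}\Lambda^i$, $\iota_{\Lambda^-}\Delta^{-1}=\sum_{i\ge1}\Lambda^{-i}$, and, for $q$ and $r$ invertible at every $s\in\mathbb Z$, $$T_+(q)=\Lambda(q)\cdot\Delta\cdot q^{-1},\qquad \iota_{\Lambda^\pm}T_+(q)^{-1}=q\cdot\iota_{\Lambda^\pm}\Delta^{-1}\cdot\Lambda(q)^{-1},$$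 $$T_-(r)=\Lambda^{-1}(r)^{-1}\cdot\Delta^{-1}\cdot r,\qquad \iota_{\Lambda^\pm}T_-(r)=\Lambda^{-1}(r)^{-1}\cdot\iota_{\Lambda^\pm}\Delta^{-1}\cdot r,\qquad T_-(r)^{-1}=r^{-1}\cdot\Delta\cdot\Lambda^{-1}(r).$$ **Theorem.** Let $(L_1,L_2)$ be a Toda Lax pair. 1. For every invertible Toda eigenfunction $q$ of $(L_1,L_2)$, each of $\iota_{\Lambda^\pm}T_+(q)^{-1}$ is a two-sided inverse of $T_+(q)$, and $$L_1^{[1]}=T_+(q)\cdot L_1\cdot\iota_{\Lambda^-}T_+(q)^{-1},\qquad L_2^{[1]}=T_+(q)\cdot L_2\cdot\iota_{\Lambda^+}T_+(q)^{-1}$$ is again a Toda Lax pair; in particular it satisfies the Toda Lax equations. 2. For every invertible adjoint Toda eigenfunction $r$ of $(L_1,L_2)$, $T_-(r)^{-1}$ is a two-sided inverse of each of $\iota_{\Lambda^\pm}T_-(r)$, and $$L_1^{[1]}=\iota_{\Lambda^-}T_-(r)\cdot L_1\cdot T_-(r)^{-1},\qquad L_2^{[1]}=\iota_{\Lambda^+}T_-(r)\cdot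 L_2\cdot T_-(r)^{-1}$$ is again a Toda Lax pair; in particular it satisfies the Toda Lax equations. -/

import Mathlib

noncomputable section

namespace Toda

/-- The shift `Λ ^ n` acting on functions of the lattice variable `s ∈ ℤ` with values in a
commutative ring `R` (of functions of the times): `(Λ ^ n f)(s) = f (s + n)`. -/
def shift (R : Type*) [CommRing R] (n : ℤ) : (ℤ → R) →+* (ℤ → R) where
  toFun f s := f (s + n)
  map_one' := rfl
  map_mul' _ _ := rfl
  map_zero' := rfl
  map_add' _ _ := rfl

/-- Formal difference operators `A = ∑ i ∈ ℤ, a_i(s) Λ ^ i`, where `A i s` is the coefficient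
`a_i(s)`. Products are taken only inside the rings of operators with degrees bounded above
(`BddAboveDeg`) or with degrees bounded below (`BddBelowDeg`). -/
def DiffOp (R : Type*) : Type _ := ℤ → ℤ → R

variable {R : Type*}

/-- `A` is a formal Laurent series in `Λ⁻¹`. -/
def BddAboveDeg [CommRing R] (A : DiffOp R) : Prop := ∃ N : ℤ, ∀ i s : ℤ, N < i → A i s = 0

/-- `A` is a formal Laurent series in `Λ`. -/
def BddBelowDeg [CommRing R] (A : DiffOp R) : Prop := ∃ N : ℤ, ∀ i s : ℤ, i < N → A i s = 0

instance [CommRing R] : AddCommGroup (DiffOp R) := inferInstanceAs (AddCommGroup (ℤ → ℤ → R))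

/-- The operator of multiplication by the function `f` of `s`. -/
def ofFun [CommRing R] (f : ℤ → R) : DiffOp R := fun i s => if i = 0 then f s else 0

/-- The operator `Λ ^ n`. -/
def Lam (R : Type*) [CommRing R] (n : ℤ) : DiffOp R := fun i _ => if i = n then 1 else 0

instance [CommRing R] : One (DiffOp R) := ⟨ofFun 1⟩

/-- Composition, determined by `(a(s) Λ ^ i) (b(s) Λ ^ j) = a(s) b(s + i) Λ ^ (i + j)`. -/
instance [CommRing R] : Mul (DiffOp R) := ⟨fun A B n s => ∑ᶠ i : ℤ, A i s * B (n - i) (s + i)⟩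

/-- Only finitely many terms contribute to a product of operators with degrees bounded above. -/
theorem mul_support_finite_of_bddAboveDeg [CommRing R] {A B : DiffOp R} (hA : BddAboveDeg A)
    (hB : BddAboveDeg B) (n s : ℤ) :
    (Function.support fun i : ℤ => A i s * B (n - i) (s + i)).Finite := by
  obtain ⟨N, hN⟩ := hA
  obtain ⟨M, hM⟩ := hB
  refine (Set.finite_Icc (n - M) N).subset fun i hi => ?_
  by_contra h
  rw [Set.mem_Icc, not_and_or, not_le, not_le] at h
  rcases h with h | h
  · exact hi (by simp [hM (n - i) (s + i) (by omega)])
  · exact hi (by simp [hN i s h])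

/-- Only finitely many terms contribute to a product of operators with degrees bounded below. -/
theorem mul_support_finite_of_bddBelowDeg [CommRing R] {A B : DiffOp R} (hA : BddBelowDeg A)
    (hB : BddBelowDeg B) (n s : ℤ) :
    (Function.support fun i : ℤ => A i s * B (n - i) (s + i)).Finite := by
  obtain ⟨N, hN⟩ := hA
  obtain ⟨M, hM⟩ := hB
  refine (Set.finite_Icc N (n - M)).subset fun i hi => ?_
  by_contra h
  rw [Set.mem_Icc, not_and_or, not_le, not_le] at h
  rcases h with h | h
  · exact hi (by simp [hN i s h])
  · exact hi (by simp [hM (n - i) (s + i) (by omega)])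

/-- Iterated composition: `A ^ 0 = 1` and `A ^ (n + 1) = A ^ n * A`. -/
instance [CommRing R] : Pow (DiffOp R) ℕ := ⟨fun A n => npowRec n A⟩

/-- The part `A_{≥ 0} = ∑ i ≥ 0, a_i Λ ^ i`. -/
def nonnegPart [CommRing R] (A : DiffOp R) : DiffOp R := fun i s => if 0 ≤ i then A i s else 0

/-- The part `A_{< 0} = ∑ i < 0, a_i Λ ^ i`. -/
def negPart [CommRing R] (A : DiffOp R) : DiffOp R := fun i s => if i < 0 then A i s else 0

/-- The formal adjoint `(∑ a_i(s) Λ ^ i)* = ∑ Λ ^ (-i) a_i(s) = ∑ a_i(s - i) Λ ^ (-i)`. -/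
def adj [CommRing R] (A : DiffOp R) : DiffOp R := fun j s => A (-j) (s + j)

/-- The action `A(f)(s) = ∑ i, a_i(s) f(s + i)` of an operator on a function; it is used only for
operators with finitely many nonzero coefficients `a_i`. -/
def act [CommRing R] (A : DiffOp R) (f : ℤ → R) : ℤ → R := fun s => ∑ᶠ i : ℤ, A i s * f (s + i)

/-- The commutator. -/
def comm [CommRing R] (A B : DiffOp R) : DiffOp R := A * B - B * A

/-- A derivation of `R` applied to all coefficients of an operator. -/
def deriv [CommRing R] [Algebra ℂ R] (D : Derivation ℂ R R) (A : DiffOp R) : DiffOp R :=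
  fun i s => D (A i s)

/-- `L₁ = S₁ Λ S₁⁻¹` with `S₁ = 1 + ∑ i ≥ 1, f_i Λ ^ (-i)`, where `S₁⁻¹` (here `S'`) is the inverse
in the ring of Laurent series in `Λ⁻¹`. -/
def IsLax₁ [CommRing R] (L : DiffOp R) : Prop :=
  ∃ S S' : DiffOp R, (∀ i s : ℤ, 0 < i → S i s = 0) ∧ (∀ s : ℤ, S 0 s = 1) ∧
    BddAboveDeg S' ∧ S * S' = 1 ∧ S' * S = 1 ∧ L = S * Lam R 1 * S'

/-- `L₂ = S₂ Λ⁻¹ S₂⁻¹` with `S₂ = g₀ + ∑ i ≥ 1, g_i Λ ^ i` and `g₀` invertible, where `S₂⁻¹`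
(here `S'`) is the inverse in the ring of Laurent series in `Λ`. -/
def IsLax₂ [CommRing R] (L : DiffOp R) : Prop :=
  ∃ S S' : DiffOp R, (∀ i s : ℤ, i < 0 → S i s = 0) ∧ (∀ s : ℤ, IsUnit (S 0 s)) ∧
    BddBelowDeg S' ∧ S * S' = 1 ∧ S' * S = 1 ∧ L = S * Lam R (-1) * S'

/-- `(L₁, L₂)` is a pair of Lax operators satisfying the Lax equations of the 2-Toda hierarchy.
`D₁ p` and `D₂ p` (for `p ≥ 1`) are the derivations by the times `t_p^{(1)}` and `t_p^{(2)}`. -/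
structure IsTodaLaxPair [CommRing R] [Algebra ℂ R] (D₁ D₂ : ℕ → Derivation ℂ R R)
    (L₁ L₂ : DiffOp R) : Prop where
  lax₁ : IsLax₁ L₁
  lax₂ : IsLax₂ L₂
  eq₁₁ : ∀ p : ℕ, 1 ≤ p → deriv (D₁ p) L₁ = comm (nonnegPart (L₁ ^ p)) L₁
  eq₂₁ : ∀ p : ℕ, 1 ≤ p → deriv (D₂ p) L₁ = comm (negPart (L₂ ^ p)) L₁
  eq₁₂ : ∀ p : ℕ, 1 ≤ p → deriv (D₁ p) L₂ = comm (nonnegPart (L₁ ^ p)) L₂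
  eq₂₂ : ∀ p : ℕ, 1 ≤ p → deriv (D₂ p) L₂ = comm (negPart (L₂ ^ p)) L₂

/-- Toda eigenfunctions. -/
def IsEigenfunction [CommRing R] [Algebra ℂ R] (D₁ D₂ : ℕ → Derivation ℂ R R)
    (L₁ L₂ : DiffOp R) (q : ℤ → R) : Prop :=
  ∀ p : ℕ, 1 ≤ p → ∀ s : ℤ,
    D₁ p (q s) = act (nonnegPart (L₁ ^ p)) q s ∧ D₂ p (q s) = act (negPart (L₂ ^ p)) q s

/-- Adjoint Toda eigenfunctions. -/
def IsAdjointEigenfunction [CommRing R] [Algebra ℂ R] (D₁ D₂ : ℕ → Derivation ℂ R R)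
    (L₁ L₂ : DiffOp R) (r : ℤ → R) : Prop :=
  ∀ p : ℕ, 1 ≤ p → ∀ s : ℤ,
    D₁ p (r s) = -act (adj (nonnegPart (L₁ ^ p))) r s ∧
    D₂ p (r s) = -act (adj (negPart (L₂ ^ p))) r s

/-- `Δ = Λ - 1`. -/
def Delta (R : Type*) [CommRing R] : DiffOp R := Lam R 1 - 1

/-- The expansion `ι_{Λ⁺} Δ⁻¹ = -∑ i ≥ 0, Λ ^ i`. -/
def iotaPlusDeltaInv (R : Type*) [CommRing R] : DiffOp R := fun i _ => if 0 ≤ i then -1 else 0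

/-- The expansion `ι_{Λ⁻} Δ⁻¹ = ∑ i ≥ 1, Λ ^ (-i)`. -/
def iotaMinusDeltaInv (R : Type*) [CommRing R] : DiffOp R := fun i _ => if i < 0 then 1 else 0

/-- The function `Λ ^ n (f)`, for an invertible function `f`, as an invertible function. -/
def shiftUnit [CommRing R] (n : ℤ) (f : (ℤ → R)ˣ) : (ℤ → R)ˣ :=
  Units.map (shift R n : (ℤ → R) →* (ℤ → R)) f

/-- `T₊(q) = Λ(q) · Δ · q⁻¹`. -/
def TPlus [CommRing R] (q : (ℤ → R)ˣ) : DiffOp R :=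
  ofFun ↑(shiftUnit 1 q) * Delta R * ofFun ↑q⁻¹

/-- `ι_{Λ⁺} T₊(q)⁻¹ = q · ι_{Λ⁺} Δ⁻¹ · Λ(q)⁻¹`. -/
def iotaPlusTPlusInv [CommRing R] (q : (ℤ → R)ˣ) : DiffOp R :=
  ofFun ↑q * iotaPlusDeltaInv R * ofFun ↑(shiftUnit 1 q)⁻¹

/-- `ι_{Λ⁻} T₊(q)⁻¹ = q · ι_{Λ⁻} Δ⁻¹ · Λ(q)⁻¹`. -/
def iotaMinusTPlusInv [CommRing R] (q : (ℤ → R)ˣ) : DiffOp R :=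
  ofFun ↑q * iotaMinusDeltaInv R * ofFun ↑(shiftUnit 1 q)⁻¹

/-- `ι_{Λ⁺} T₋(r) = Λ⁻¹(r)⁻¹ · ι_{Λ⁺} Δ⁻¹ · r`, for `T₋(r) = Λ⁻¹(r)⁻¹ · Δ⁻¹ · r`. -/
def iotaPlusTMinus [CommRing R] (r : (ℤ → R)ˣ) : DiffOp R :=
  ofFun ↑(shiftUnit (-1) r)⁻¹ * iotaPlusDeltaInv R * ofFun ↑r

/-- `ι_{Λ⁻} T₋(r) = Λ⁻¹(r)⁻¹ · ι_{Λ⁻} Δ⁻¹ · r`, for `T₋(r) = Λ⁻¹(r)⁻¹ · Δ⁻¹ · r`. -/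
def iotaMinusTMinus [CommRing R] (r : (ℤ → R)ˣ) : DiffOp R :=
  ofFun ↑(shiftUnit (-1) r)⁻¹ * iotaMinusDeltaInv R * ofFun ↑r

/-- `T₋(r)⁻¹ = r⁻¹ · Δ · Λ⁻¹(r)`. -/
def TMinusInv [CommRing R] (r : (ℤ → R)ˣ) : DiffOp R :=
  ofFun ↑r⁻¹ * Delta R * ofFun ↑(shiftUnit (-1) r)

end Toda

end

/-! Both parts are gauge transformations. If `P * Q = 1 = Q * P`, conjugation by `P` turns a Lax
equation with generator `B` into one with generator `D P * Q + P * B * Q` (`lax_conj`). Here `L₁` is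
conjugated in the ring of series in `Λ⁻¹` and `L₂` in that of series in `Λ`, so the two new
generators must be shown to coincide and to be the correct truncation.

Coincidence is where eigenfunctions enter. The expansions of `T₊(q)⁻¹` differ by `∑ q Λ^i Λ(q)⁻¹`,
and left multiplication by a finite operator `X` kills this as soon as `X(q) = 0`. For `X = D T + T
B` with `T = T₊(q)` and `D q = B(q)`, one has `X(q) = D(T(q)) = 0` because `T(q) = 0`
(`TPlus_gauge`). For adjoint eigenfunctions, `T₋(r)` is the inverse of `T₊(q)` with `q = Λ⁻¹(r)⁻¹`,
and the dual computation uses `T*(r) = 0` (`TMinus_gauge`).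

Truncation is then a degree count (`IsTodaLaxPair.conj`): the gauge operator in `Λ⁻¹` is monic, so
its derivative loses a degree and `D P₁ * Q₁` is purely negative, whereas `D P₂ * Q₂` has only
nonnegative degrees. -/

namespace Toda

variable {R : Type*} [CommRing R]

/-! ### Degree bounds and extreme coefficients of products. -/

/-- All coefficients of degree greater than `N` vanish. -/
def DegLE (N : ℤ) (A : DiffOp R) : Prop := ∀ i s : ℤ, N < i → A i s = 0

/-- All coefficients of degree less than `N` vanish. -/
def DegGE (N : ℤ) (A : DiffOp R) : Prop := ∀ i s : ℤ, i < N → A i s = 0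

theorem DegLE.bddAbove {N : ℤ} {A : DiffOp R} (h : DegLE N A) : BddAboveDeg A := ⟨N, h⟩

theorem DegGE.bddBelow {N : ℤ} {A : DiffOp R} (h : DegGE N A) : BddBelowDeg A := ⟨N, h⟩

@[simp] theorem add_apply (A B : DiffOp R) (i s : ℤ) : (A + B) i s = A i s + B i s := rfl

@[simp] theorem sub_apply (A B : DiffOp R) (i s : ℤ) : (A - B) i s = A i s - B i s := rfl

@[simp] theorem neg_apply (A : DiffOp R) (i s : ℤ) : (-A) i s = -A i s := rfl

@[simp] theorem zero_apply (i s : ℤ) : (0 : DiffOp R) i s = 0 := rfl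

theorem one_apply (i s : ℤ) : (1 : DiffOp R) i s = if i = 0 then 1 else 0 := rfl

theorem mul_apply (A B : DiffOp R) (n s : ℤ) :
    (A * B) n s = ∑ᶠ i : ℤ, A i s * B (n - i) (s + i) := rfl

theorem DiffOp.ext {R : Type*} {A B : DiffOp R} (h : ∀ i s, A i s = B i s) : A = B :=
  funext fun i => funext fun s => h i s

theorem DegLE.mono {N M : ℤ} {A : DiffOp R} (h : DegLE N A) (hNM : N ≤ M) : DegLE M A :=
  fun i s hi => h i s (by omega)

theorem DegLE.add {N : ℤ} {A B : DiffOp R} (hA : DegLE N A) (hB : DegLE N B) : DegLE N (A + B) :=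
  fun i s hi => by simp [hA i s hi, hB i s hi]

theorem DegGE.add {N : ℤ} {A B : DiffOp R} (hA : DegGE N A) (hB : DegGE N B) : DegGE N (A + B) :=
  fun i s hi => by simp [hA i s hi, hB i s hi]

theorem DegLE.mul {N M : ℤ} {A B : DiffOp R} (hA : DegLE N A) (hB : DegLE M B) :
    DegLE (N + M) (A * B) := fun n s hn => by
  rw [mul_apply, finsum_eq_zero_of_forall_eq_zero]
  intro i
  rcases lt_or_ge N i with h | h
  · rw [hA i s h, zero_mul]
  · rw [hB (n - i) _ (by omega), mul_zero]

theorem DegGE.mul {N M : ℤ} {A B : DiffOp R} (hA : DegGE N A) (hB : DegGE M B) :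
    DegGE (N + M) (A * B) := fun n s hn => by
  rw [mul_apply, finsum_eq_zero_of_forall_eq_zero]
  intro i
  rcases lt_or_ge i N with h | h
  · rw [hA i s h, zero_mul]
  · rw [hB (n - i) _ (by omega), mul_zero]

/-- The leading coefficient of a product. -/
theorem DegLE.mul_apply_top {N M : ℤ} {A B : DiffOp R} (hA : DegLE N A) (hB : DegLE M B)
    (s : ℤ) : (A * B) (N + M) s = A N s * B M (s + N) := by
  rw [mul_apply, finsum_eq_single _ N]
  · rw [add_sub_cancel_left]
  · intro i hi
    rcases lt_or_ge N i with h | h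
    · rw [hA i s h, zero_mul]
    · rw [hB _ _ (by omega), mul_zero]

/-- The lowest coefficient of a product. -/
theorem DegGE.mul_apply_bot {N M : ℤ} {A B : DiffOp R} (hA : DegGE N A) (hB : DegGE M B)
    (s : ℤ) : (A * B) (N + M) s = A N s * B M (s + N) := by
  rw [mul_apply, finsum_eq_single _ N]
  · rw [add_sub_cancel_left]
  · intro i hi
    rcases lt_or_ge i N with h | h
    · rw [hA i s h, zero_mul]
    · rw [hB _ _ (by omega), mul_zero]

theorem degLE_one : DegLE 0 (1 : DiffOp R) := fun i s hi => by
  rw [one_apply, if_neg (by omega)]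

theorem degGE_one : DegGE 0 (1 : DiffOp R) := fun i s hi => by
  rw [one_apply, if_neg (by omega)]

theorem degLE_Lam (n : ℤ) : DegLE n (Lam R n) := fun i s hi => by
  rw [Lam, if_neg (by omega)]

theorem degGE_Lam (n : ℤ) : DegGE n (Lam R n) := fun i s hi => by
  rw [Lam, if_neg (by omega)]

theorem BddAboveDeg.mul {A B : DiffOp R} (hA : BddAboveDeg A) (hB : BddAboveDeg B) :
    BddAboveDeg (A * B) :=
  let ⟨_, hN⟩ := hA
  let ⟨_, hM⟩ := hB
  (DegLE.mul hN hM).bddAbove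

theorem BddBelowDeg.mul {A B : DiffOp R} (hA : BddBelowDeg A) (hB : BddBelowDeg B) :
    BddBelowDeg (A * B) :=
  let ⟨_, hN⟩ := hA
  let ⟨_, hM⟩ := hB
  (DegGE.mul hN hM).bddBelow

theorem BddAboveDeg.add {A B : DiffOp R} (hA : BddAboveDeg A) (hB : BddAboveDeg B) :
    BddAboveDeg (A + B) := by
  obtain ⟨N, hN⟩ := hA
  obtain ⟨M, hM⟩ := hB
  refine ⟨max N M, fun i s hi => ?_⟩
  simp [hN i s (by omega), hM i s (by omega)]

theorem BddBelowDeg.add {A B : DiffOp R} (hA : BddBelowDeg A) (hB : BddBelowDeg B) :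
    BddBelowDeg (A + B) := by
  obtain ⟨N, hN⟩ := hA
  obtain ⟨M, hM⟩ := hB
  refine ⟨min N M, fun i s hi => ?_⟩
  simp [hN i s (by omega), hM i s (by omega)]

theorem BddAboveDeg.neg {A : DiffOp R} (hA : BddAboveDeg A) : BddAboveDeg (-A) := by
  obtain ⟨N, hN⟩ := hA
  exact ⟨N, fun i s hi => by simp [hN i s hi]⟩

theorem BddBelowDeg.neg {A : DiffOp R} (hA : BddBelowDeg A) : BddBelowDeg (-A) := by
  obtain ⟨N, hN⟩ := hA
  exact ⟨N, fun i s hi => by simp [hN i s hi]⟩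

/-! ### Ring laws for operators bounded on one side. -/

theorem one_mul_diffOp (A : DiffOp R) : 1 * A = A := DiffOp.ext fun n s => by
  rw [mul_apply, finsum_eq_single _ 0]
  · simp [one_apply]
  · intro i hi
    simp [one_apply, hi]

theorem mul_one_diffOp (A : DiffOp R) : A * 1 = A := DiffOp.ext fun n s => by
  rw [mul_apply, finsum_eq_single _ n]
  · simp [one_apply]
  · intro i hi
    rw [one_apply, if_neg (by omega), mul_zero]

theorem mul_apply_eq_sum {A B : DiffOp R} {n s : ℤ} (t : Finset ℤ)
    (h : ∀ i ∉ t, A i s * B (n - i) (s + i) = 0) :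
    (A * B) n s = ∑ i ∈ t, A i s * B (n - i) (s + i) := by
  rw [mul_apply]
  refine finsum_eq_sum_of_support_subset _ fun i hi => ?_
  by_contra hit
  exact hi (h i hit)

/-- The degree bounds confine both indices of the double sum to fixed finite intervals, after which
the two orders of summation can be exchanged. -/
theorem mul_assoc_of_bddAboveDeg {A B C : DiffOp R} (hA : BddAboveDeg A) (hB : BddAboveDeg B)
    (hC : BddAboveDeg C) : A * B * C = A * (B * C) := by
  obtain ⟨a, ha⟩ := hA
  obtain ⟨b, hb⟩ := hB
  obtain ⟨c, hc⟩ := hC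
  refine DiffOp.ext fun n s => ?_
  rw [mul_apply_eq_sum (Finset.Icc (n - c) (a + b)), mul_apply_eq_sum (Finset.Icc (n - b - c) a)]
  · have h₁ : ∀ k ∈ Finset.Icc (n - c) (a + b), (A * B) k s * C (n - k) (s + k) =
        ∑ i ∈ Finset.Icc (n - b - c) a, A i s * B (k - i) (s + i) * C (n - k) (s + k) := by
      intro k hk
      rw [Finset.mem_Icc] at hk
      rw [← Finset.sum_mul, mul_apply_eq_sum]
      intro i hi
      rw [Finset.mem_Icc, not_and_or, not_le, not_le] at hi
      rcases hi with h | h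
      · rw [hb (k - i) _ (by omega), mul_zero]
      · rw [ha i s h, zero_mul]
    have h₂ : ∀ i ∈ Finset.Icc (n - b - c) a, A i s * (B * C) (n - i) (s + i) =
        ∑ k ∈ Finset.Icc (n - c) (a + b), A i s * B (k - i) (s + i) * C (n - k) (s + k) := by
      intro i hi
      rw [Finset.mem_Icc] at hi
      rw [mul_apply_eq_sum ((Finset.Icc (n - c) (a + b)).image (· - i)), Finset.sum_image,
        Finset.mul_sum]
      · refine Finset.sum_congr rfl fun k _ => ?_
        rw [mul_assoc, show n - i - (k - i) = n - k by ring, show s + i + (k - i) = s + k by ring]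
      · intro x _ y _ h
        simpa using h
      · intro j hj
        have hj' : j + i ∉ Finset.Icc (n - c) (a + b) := fun h =>
          hj (Finset.mem_image.2 ⟨j + i, h, by simp⟩)
        rw [Finset.mem_Icc, not_and_or, not_le, not_le] at hj'
        rcases hj' with h | h
        · rw [hc (n - i - j) _ (by omega), mul_zero]
        · rw [hb j _ (by omega), zero_mul]
    rw [Finset.sum_congr rfl h₁, Finset.sum_congr rfl h₂, Finset.sum_comm]
  · intro i hi
    rw [Finset.mem_Icc, not_and_or, not_le, not_le] at hi
    rcases hi with h | h
    · rw [DegLE.mul hb hc (n - i) _ (by omega), mul_zero]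
    · rw [ha i s h, zero_mul]
  · intro k hk
    rw [Finset.mem_Icc, not_and_or, not_le, not_le] at hk
    rcases hk with h | h
    · rw [hc (n - k) _ (by omega), mul_zero]
    · rw [DegLE.mul ha hb k s h, zero_mul]

/-- The image of an operator under `Λ ↦ Λ⁻¹`, `s ↦ -s`. -/
def reflect {R : Type*} (A : DiffOp R) : DiffOp R := fun i s => A (-i) (-s)

theorem reflect_reflect {R : Type*} (A : DiffOp R) : reflect (reflect A) = A := by
  funext i s
  simp [reflect]

theorem reflect_mul (A B : DiffOp R) : reflect (A * B) = reflect A * reflect B := by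
  refine DiffOp.ext fun n s => ?_
  rw [reflect, mul_apply, mul_apply, ← finsum_comp_equiv (Equiv.neg ℤ)]
  refine finsum_congr fun i => ?_
  simp only [reflect, Equiv.neg_apply]
  rw [show -(n - i) = -n - -i by ring, show -(s + i) = -s + -i by ring]

theorem BddBelowDeg.reflect {A : DiffOp R} (hA : BddBelowDeg A) : BddAboveDeg (reflect A) := by
  obtain ⟨N, hN⟩ := hA
  exact ⟨-N, fun i s hi => hN _ _ (by omega)⟩

/-- The multiplicative involution `reflect` exchanges the two kinds of Laurent series, so the
previous case applies. -/
theorem mul_assoc_of_bddBelowDeg {A B C : DiffOp R} (hA : BddBelowDeg A) (hB : BddBelowDeg B)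
    (hC : BddBelowDeg C) : A * B * C = A * (B * C) := by
  have h := mul_assoc_of_bddAboveDeg hA.reflect hB.reflect hC.reflect
  rw [← reflect_mul, ← reflect_mul, ← reflect_mul, ← reflect_mul] at h
  rw [← reflect_reflect (A * B * C), h, reflect_reflect]

theorem mul_add_of_bddAboveDeg {A B C : DiffOp R} (hA : BddAboveDeg A) (hB : BddAboveDeg B)
    (hC : BddAboveDeg C) : A * (B + C) = A * B + A * C := DiffOp.ext fun n s => by
  rw [add_apply, mul_apply, mul_apply, mul_apply, ← finsum_add_distrib
    (mul_support_finite_of_bddAboveDeg hA hB n s) (mul_support_finite_of_bddAboveDeg hA hC n s)]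
  exact finsum_congr fun i => mul_add _ _ _

theorem add_mul_of_bddAboveDeg {A B C : DiffOp R} (hA : BddAboveDeg A) (hB : BddAboveDeg B)
    (hC : BddAboveDeg C) : (A + B) * C = A * C + B * C := DiffOp.ext fun n s => by
  rw [add_apply, mul_apply, mul_apply, mul_apply, ← finsum_add_distrib
    (mul_support_finite_of_bddAboveDeg hA hC n s) (mul_support_finite_of_bddAboveDeg hB hC n s)]
  exact finsum_congr fun i => add_mul _ _ _

theorem mul_add_of_bddBelowDeg {A B C : DiffOp R} (hA : BddBelowDeg A) (hB : BddBelowDeg B)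
    (hC : BddBelowDeg C) : A * (B + C) = A * B + A * C := DiffOp.ext fun n s => by
  rw [add_apply, mul_apply, mul_apply, mul_apply, ← finsum_add_distrib
    (mul_support_finite_of_bddBelowDeg hA hB n s) (mul_support_finite_of_bddBelowDeg hA hC n s)]
  exact finsum_congr fun i => mul_add _ _ _

theorem add_mul_of_bddBelowDeg {A B C : DiffOp R} (hA : BddBelowDeg A) (hB : BddBelowDeg B)
    (hC : BddBelowDeg C) : (A + B) * C = A * C + B * C := DiffOp.ext fun n s => by
  rw [add_apply, mul_apply, mul_apply, mul_apply, ← finsum_add_distrib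
    (mul_support_finite_of_bddBelowDeg hA hC n s) (mul_support_finite_of_bddBelowDeg hB hC n s)]
  exact finsum_congr fun i => add_mul _ _ _

theorem zero_mul_diffOp (A : DiffOp R) : 0 * A = 0 := DiffOp.ext fun n s => by
  simp [mul_apply]

theorem mul_zero_diffOp (A : DiffOp R) : A * 0 = 0 := DiffOp.ext fun n s => by
  simp [mul_apply]

/-! ### The two rings of Laurent series. -/

variable (R) in
/-- The Laurent series in `Λ⁻¹`. -/
def AboveOp : Type _ := {A : DiffOp R // BddAboveDeg A}

variable (R) in
/-- The Laurent series in `Λ`. -/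
def BelowOp : Type _ := {A : DiffOp R // BddBelowDeg A}

instance : Zero (AboveOp R) := ⟨⟨0, 0, fun _ _ _ => rfl⟩⟩

instance : Add (AboveOp R) := ⟨fun A B => ⟨A.1 + B.1, A.2.add B.2⟩⟩

instance : Neg (AboveOp R) := ⟨fun A => ⟨-A.1, A.2.neg⟩⟩

instance : Sub (AboveOp R) :=
  ⟨fun A B => ⟨A.1 - B.1, sub_eq_add_neg A.1 B.1 ▸ A.2.add B.2.neg⟩⟩

noncomputable instance : Mul (AboveOp R) := ⟨fun A B => ⟨A.1 * B.1, A.2.mul B.2⟩⟩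

noncomputable instance : One (AboveOp R) := ⟨⟨1, degLE_one.bddAbove⟩⟩

noncomputable instance : Ring (AboveOp R) where
  add_assoc _ _ _ := Subtype.ext (add_assoc _ _ _)
  zero_add _ := Subtype.ext (zero_add _)
  add_zero _ := Subtype.ext (add_zero _)
  add_comm _ _ := Subtype.ext (add_comm _ _)
  sub_eq_add_neg _ _ := Subtype.ext (sub_eq_add_neg _ _)
  neg_add_cancel _ := Subtype.ext (neg_add_cancel _)
  mul_assoc A B C := Subtype.ext (mul_assoc_of_bddAboveDeg A.2 B.2 C.2)
  one_mul _ := Subtype.ext (one_mul_diffOp _)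
  mul_one _ := Subtype.ext (mul_one_diffOp _)
  left_distrib A B C := Subtype.ext (mul_add_of_bddAboveDeg A.2 B.2 C.2)
  right_distrib A B C := Subtype.ext (add_mul_of_bddAboveDeg A.2 B.2 C.2)
  zero_mul _ := Subtype.ext (zero_mul_diffOp _)
  mul_zero _ := Subtype.ext (mul_zero_diffOp _)
  nsmul := nsmulRec
  zsmul := zsmulRec

instance : Zero (BelowOp R) := ⟨⟨0, 0, fun _ _ _ => rfl⟩⟩

instance : Add (BelowOp R) := ⟨fun A B => ⟨A.1 + B.1, A.2.add B.2⟩⟩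

instance : Neg (BelowOp R) := ⟨fun A => ⟨-A.1, A.2.neg⟩⟩

instance : Sub (BelowOp R) :=
  ⟨fun A B => ⟨A.1 - B.1, sub_eq_add_neg A.1 B.1 ▸ A.2.add B.2.neg⟩⟩

noncomputable instance : Mul (BelowOp R) := ⟨fun A B => ⟨A.1 * B.1, A.2.mul B.2⟩⟩

noncomputable instance : One (BelowOp R) := ⟨⟨1, degGE_one.bddBelow⟩⟩

noncomputable instance : Ring (BelowOp R) where
  add_assoc _ _ _ := Subtype.ext (add_assoc _ _ _)
  zero_add _ := Subtype.ext (zero_add _)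
  add_zero _ := Subtype.ext (add_zero _)
  add_comm _ _ := Subtype.ext (add_comm _ _)
  sub_eq_add_neg _ _ := Subtype.ext (sub_eq_add_neg _ _)
  neg_add_cancel _ := Subtype.ext (neg_add_cancel _)
  mul_assoc A B C := Subtype.ext (mul_assoc_of_bddBelowDeg A.2 B.2 C.2)
  one_mul _ := Subtype.ext (one_mul_diffOp _)
  mul_one _ := Subtype.ext (mul_one_diffOp _)
  left_distrib A B C := Subtype.ext (mul_add_of_bddBelowDeg A.2 B.2 C.2)
  right_distrib A B C := Subtype.ext (add_mul_of_bddBelowDeg A.2 B.2 C.2)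
  zero_mul _ := Subtype.ext (zero_mul_diffOp _)
  mul_zero _ := Subtype.ext (mul_zero_diffOp _)
  nsmul := nsmulRec
  zsmul := zsmulRec

theorem pow_succ_diffOp (A : DiffOp R) (n : ℕ) : A ^ (n + 1) = A ^ n * A := rfl

theorem AboveOp.coe_pow (A : AboveOp R) (n : ℕ) : (A ^ n).1 = A.1 ^ n := by
  induction n with
  | zero => rfl
  | succ n ih =>
    rw [pow_succ, pow_succ_diffOp, ← ih]
    rfl

theorem BelowOp.coe_pow (A : BelowOp R) (n : ℕ) : (A ^ n).1 = A.1 ^ n := by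
  induction n with
  | zero => rfl
  | succ n ih =>
    rw [pow_succ, pow_succ_diffOp, ← ih]
    rfl

/-! ### Truncations and conjugation of dressed operators. -/

theorem degGE_nonnegPart (A : DiffOp R) : DegGE 0 (nonnegPart A) := fun i s hi => by
  rw [nonnegPart, if_neg (by omega)]

theorem degLE_negPart (A : DiffOp R) : DegLE (-1) (negPart A) := fun i s hi => by
  rw [negPart, if_neg (by omega)]

theorem BddAboveDeg.nonnegPart {A : DiffOp R} (hA : BddAboveDeg A) :
    BddAboveDeg (nonnegPart A) := by
  obtain ⟨N, hN⟩ := hA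
  exact ⟨N, fun i s hi => by simp [Toda.nonnegPart, hN i s hi]⟩

theorem BddBelowDeg.negPart {A : DiffOp R} (hA : BddBelowDeg A) : BddBelowDeg (negPart A) := by
  obtain ⟨N, hN⟩ := hA
  exact ⟨N, fun i s hi => by simp [Toda.negPart, hN i s hi]⟩

theorem nonnegPart_add_negPart (A : DiffOp R) : nonnegPart A + negPart A = A :=
  DiffOp.ext fun i s => by
    rw [add_apply, nonnegPart, negPart]
    split_ifs <;> first | omega | simp

/-- Uniqueness of the splitting by degree; it is the means of recognizing a gauge-transformed
generator as a truncation. -/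
theorem nonnegPart_eq_of_eq_add {A B C : DiffOp R} (h : A = B + C) (hB : DegGE 0 B)
    (hC : DegLE (-1) C) : nonnegPart A = B := DiffOp.ext fun i s => by
  rw [nonnegPart, h]
  split_ifs with hi
  · rw [add_apply, hC i s (by omega), add_zero]
  · rw [hB i s (by omega)]

theorem negPart_eq_of_eq_add {A B C : DiffOp R} (h : A = B + C) (hB : DegGE 0 B)
    (hC : DegLE (-1) C) : negPart A = C := DiffOp.ext fun i s => by
  rw [negPart, h]
  split_ifs with hi
  · rw [add_apply, hB i s hi, zero_add]
  · rw [hC i s (by omega)]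

theorem IsLax₁.bddAboveDeg {L : DiffOp R} (h : IsLax₁ L) : BddAboveDeg L := by
  obtain ⟨S, S', hS, -, hS', -, -, rfl⟩ := h
  exact (BddAboveDeg.mul ⟨0, hS⟩ (degLE_Lam 1).bddAbove).mul hS'

theorem IsLax₂.bddBelowDeg {L : DiffOp R} (h : IsLax₂ L) : BddBelowDeg L := by
  obtain ⟨S, S', hS, -, hS', -, -, rfl⟩ := h
  exact (BddBelowDeg.mul ⟨0, hS⟩ (degGE_Lam (-1)).bddBelow).mul hS'

theorem Lam_mul_Lam (m n : ℤ) : Lam R m * Lam R n = Lam R (m + n) := DiffOp.ext fun k s => by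
  rw [mul_apply, finsum_eq_single _ m]
  · simp only [Lam, if_true, one_mul]
    exact if_congr (by omega) rfl rfl
  · intro i hi
    simp [Lam, hi]

theorem Lam_zero : Lam R 0 = 1 := rfl

/-- Conjugating a dressed operator by `P`, whose leading coefficient is `1`. -/
theorem IsLax₁.conj {L P Q : DiffOp R} (h : IsLax₁ L) {a : ℤ} (hP : DegLE a P)
    (hP₁ : ∀ s, P a s = 1) (hQ : BddAboveDeg Q) (hPQ : P * Q = 1) (hQP : Q * P = 1) :
    IsLax₁ (P * L * Q) := by
  obtain ⟨S, S', hS, hS₁, hS', hSS, hSS', rfl⟩ := h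
  have hS : DegLE 0 S := hS
  let p : AboveOp R := ⟨P, hP.bddAbove⟩
  let q : AboveOp R := ⟨Q, hQ⟩
  let σ : AboveOp R := ⟨S, hS.bddAbove⟩
  let σ' : AboveOp R := ⟨S', hS'⟩
  let l (n : ℤ) : AboveOp R := ⟨Lam R n, (degLE_Lam n).bddAbove⟩
  have hl (m n : ℤ) : l m * l n = l (m + n) := Subtype.ext (Lam_mul_Lam m n)
  have hl₀ : l 0 = 1 := Subtype.ext Lam_zero
  have hpq : p * q = 1 := Subtype.ext hPQ
  have hqp : q * p = 1 := Subtype.ext hQP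
  have hσ : σ * σ' = 1 := Subtype.ext hSS
  have hσ' : σ' * σ = 1 := Subtype.ext hSS'
  have hla : l (-a) * l a = 1 := by rw [hl, neg_add_cancel, hl₀]
  have hla' : l a * l (-a) = 1 := by rw [hl, add_neg_cancel, hl₀]
  have hPS := hP.mul hS
  have hT := hPS.mul (degLE_Lam (R := R) (-a))
  -- `P * S` has leading degree `a`; the factor `Λ^(-a)` brings it back to `0` and, commuting with
  -- `Λ`, leaves the conjugate of `Λ` unchanged.
  refine ⟨P * S * Lam R (-a), Lam R a * (S' * Q), ?_, ?_, (degLE_Lam a).bddAbove.mul (hS'.mul hQ),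
    congrArg Subtype.val (?_ : p * σ * l (-a) * (l a * (σ' * q)) = 1),
    congrArg Subtype.val (?_ : l a * (σ' * q) * (p * σ * l (-a)) = 1),
    congrArg Subtype.val (?_ : p * (σ * l 1 * σ') * q =
      p * σ * l (-a) * l 1 * (l a * (σ' * q)))⟩
  · exact hT.mono (by omega)
  · intro s
    have h := hPS.mul_apply_top (degLE_Lam (R := R) (-a)) s
    rw [hP.mul_apply_top hS, hP₁, hS₁] at h
    rw [show a + 0 + -a = 0 by ring] at h
    rw [h]
    simp [Lam]
  · calc p * σ * l (-a) * (l a * (σ' * q)) = p * (σ * (l (-a) * l a) * σ') * q := by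
          noncomm_ring
      _ = 1 := by rw [hla, mul_one, hσ, mul_one, hpq]
  · calc l a * (σ' * q) * (p * σ * l (-a)) = l a * (σ' * (q * p) * σ) * l (-a) := by
          noncomm_ring
      _ = 1 := by rw [hqp, mul_one, hσ', mul_one, hla']
  · have hla₁ : l (-a) * l 1 * l a = l 1 := by
      rw [hl, hl]
      congr 1
      ring
    calc p * (σ * l 1 * σ') * q = p * (σ * (l (-a) * l 1 * l a) * σ') * q := by rw [hla₁]
      _ = p * σ * l (-a) * l 1 * (l a * (σ' * q)) := by noncomm_ring

/-- Conjugating a dressed operator by `P`, whose lowest coefficient is invertible. -/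
theorem IsLax₂.conj {L P Q : DiffOp R} (h : IsLax₂ L) (hP : DegGE 0 P) (hQ : DegGE 0 Q)
    (hPQ : P * Q = 1) (hQP : Q * P = 1) : IsLax₂ (P * L * Q) := by
  obtain ⟨S, S', hS, hS₁, hS', hSS, hSS', rfl⟩ := h
  have hS : DegGE 0 S := hS
  let p : BelowOp R := ⟨P, hP.bddBelow⟩
  let q : BelowOp R := ⟨Q, hQ.bddBelow⟩
  let σ : BelowOp R := ⟨S, hS.bddBelow⟩
  let σ' : BelowOp R := ⟨S', hS'⟩
  let l : BelowOp R := ⟨Lam R (-1), (degGE_Lam (-1)).bddBelow⟩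
  have hpq : p * q = 1 := Subtype.ext hPQ
  have hqp : q * p = 1 := Subtype.ext hQP
  have hσ : σ * σ' = 1 := Subtype.ext hSS
  have hσ' : σ' * σ = 1 := Subtype.ext hSS'
  refine ⟨P * S, S' * Q, hP.mul hS, ?_, hS'.mul hQ.bddBelow,
    congrArg Subtype.val (?_ : p * σ * (σ' * q) = 1),
    congrArg Subtype.val (?_ : σ' * q * (p * σ) = 1),
    congrArg Subtype.val (?_ : p * (σ * l * σ') * q = p * σ * l * (σ' * q))⟩
  · intro s
    -- Neither `P` nor `Q` has negative degrees, so the lowest coefficient of `P * Q = 1` is the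
    -- product of theirs.
    have hP₀ : P 0 s * Q 0 s = 1 := by
      have h := hP.mul_apply_bot hQ s
      rw [hPQ, add_zero, add_zero] at h
      rw [← h, one_apply, if_pos rfl]
    have h := hP.mul_apply_bot hS s
    rw [add_zero, add_zero] at h
    rw [h]
    exact (IsUnit.of_mul_eq_one _ hP₀).mul (hS₁ s)
  · calc p * σ * (σ' * q) = p * (σ * σ') * q := by noncomm_ring
      _ = 1 := by rw [hσ, mul_one, hpq]
  · calc σ' * q * (p * σ) = σ' * (q * p) * σ := by noncomm_ring
      _ = 1 := by rw [hqp, mul_one, hσ']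
  · noncomm_ring

theorem conj_pow_of_bddAboveDeg {L P Q : DiffOp R} (hL : BddAboveDeg L) (hP : BddAboveDeg P)
    (hQ : BddAboveDeg Q) (hPQ : P * Q = 1) (hQP : Q * P = 1) (n : ℕ) :
    (P * L * Q) ^ n = P * L ^ n * Q := by
  let p : (AboveOp R)ˣ := ⟨⟨P, hP⟩, ⟨Q, hQ⟩, Subtype.ext hPQ, Subtype.ext hQP⟩
  have h := congrArg Subtype.val (Units.conj_pow p ⟨L, hL⟩ n)
  rw [AboveOp.coe_pow] at h
  rw [← AboveOp.coe_pow ⟨L, hL⟩]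
  exact h

theorem conj_pow_of_bddBelowDeg {L P Q : DiffOp R} (hL : BddBelowDeg L) (hP : BddBelowDeg P)
    (hQ : BddBelowDeg Q) (hPQ : P * Q = 1) (hQP : Q * P = 1) (n : ℕ) :
    (P * L * Q) ^ n = P * L ^ n * Q := by
  let p : (BelowOp R)ˣ := ⟨⟨P, hP⟩, ⟨Q, hQ⟩, Subtype.ext hPQ, Subtype.ext hQP⟩
  have h := congrArg Subtype.val (Units.conj_pow p ⟨L, hL⟩ n)
  rw [BelowOp.coe_pow] at h
  rw [← BelowOp.coe_pow ⟨L, hL⟩]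
  exact h

theorem bddAboveDeg_pow {L : DiffOp R} (hL : BddAboveDeg L) (n : ℕ) : BddAboveDeg (L ^ n) := by
  rw [← AboveOp.coe_pow ⟨L, hL⟩]
  exact Subtype.property _

theorem bddBelowDeg_pow {L : DiffOp R} (hL : BddBelowDeg L) (n : ℕ) : BddBelowDeg (L ^ n) := by
  rw [← BelowOp.coe_pow ⟨L, hL⟩]
  exact Subtype.property _

/-! ### Derivations and gauge transformation of the hierarchy. -/

/-- Gauge transformation of a Lax equation. -/
theorem lax_conj {A : Type*} [Ring A] (D : A → A) (hD : ∀ x y, D (x * y) = D x * y + x * D y)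
    {P Q L B : A} (hPQ : P * Q = 1) (hQP : Q * P = 1) (hL : D L = B * L - L * B) :
    D (P * L * Q) = (D P * Q + P * B * Q) * (P * L * Q) - P * L * Q * (D P * Q + P * B * Q) := by
  have hD₁ : D 1 = 0 := by simpa using hD 1 1
  have h₁ : P * D Q = -(D P * Q) := by
    have h := hD P Q
    rw [hPQ, hD₁] at h
    exact (neg_eq_of_add_eq_zero_right h.symm).symm
  have h₂ : D Q = -(Q * D P * Q) := by
    calc D Q = Q * P * D Q := by rw [hQP, one_mul]
      _ = _ := by rw [mul_assoc, h₁]; noncomm_ring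
  -- `noncomm_ring` does not use `Q * P = 1`, so the factor `Q * P` is isolated before rewriting.
  have h₃ : (D P * Q + P * B * Q) * (P * L * Q) =
      D P * (Q * P) * L * Q + P * B * (Q * P) * L * Q := by noncomm_ring
  have h₄ : P * L * Q * (D P * Q + P * B * Q) =
      P * L * Q * D P * Q + P * L * (Q * P) * B * Q := by noncomm_ring
  rw [h₃, h₄, hQP, hD, hD, hL, h₂]
  noncomm_ring

section Derivation

variable [Algebra ℂ R] (D : Derivation ℂ R R)

theorem deriv_apply (A : DiffOp R) (i s : ℤ) : deriv D A i s = D (A i s) := rfl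

theorem DegLE.deriv {N : ℤ} {A : DiffOp R} (h : DegLE N A) : DegLE N (deriv D A) :=
  fun i s hi => by rw [deriv_apply, h i s hi, map_zero]

theorem DegGE.deriv {N : ℤ} {A : DiffOp R} (h : DegGE N A) : DegGE N (deriv D A) :=
  fun i s hi => by rw [deriv_apply, h i s hi, map_zero]

theorem BddAboveDeg.deriv {A : DiffOp R} (h : BddAboveDeg A) : BddAboveDeg (deriv D A) :=
  let ⟨_, hN⟩ := h
  (DegLE.deriv D hN).bddAbove

theorem BddBelowDeg.deriv {A : DiffOp R} (h : BddBelowDeg A) : BddBelowDeg (deriv D A) :=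
  let ⟨_, hN⟩ := h
  (DegGE.deriv D hN).bddBelow

/-- A derivation lowers the degree of an operator with leading coefficient `1`. -/
theorem DegLE.deriv_of_monic {N : ℤ} {A : DiffOp R} (h : DegLE N A) (h₁ : ∀ s, A N s = 1) :
    DegLE (N - 1) (Toda.deriv D A) := fun i s hi => by
  rcases eq_or_ne i N with rfl | hiN
  · rw [deriv_apply, h₁, D.map_one_eq_zero]
  · exact h.deriv D i s (by omega)

/-- Finiteness of the supports lets the derivation and the addition pass through `finsum`; what
remains is the Leibniz rule termwise. -/
theorem deriv_mul_of_finite (A B : DiffOp R)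
    (h : ∀ n s, (Function.support fun i : ℤ => A i s * B (n - i) (s + i)).Finite)
    (h₁ : ∀ n s, (Function.support fun i : ℤ => deriv D A i s * B (n - i) (s + i)).Finite)
    (h₂ : ∀ n s, (Function.support fun i : ℤ => A i s * deriv D B (n - i) (s + i)).Finite) :
    deriv D (A * B) = deriv D A * B + A * deriv D B := DiffOp.ext fun n s => by
  have h₃ := (D : R →ₗ[ℂ] R).toAddMonoidHom.map_finsum (h n s)
  rw [add_apply, mul_apply, mul_apply, ← finsum_add_distrib (h₁ n s) (h₂ n s)]
  refine h₃.trans (finsum_congr fun i => ?_)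
  refine (D.leibniz _ _).trans ?_
  rw [smul_eq_mul, smul_eq_mul, deriv_apply, deriv_apply]
  ring

theorem deriv_mul_of_bddAboveDeg {A B : DiffOp R} (hA : BddAboveDeg A) (hB : BddAboveDeg B) :
    deriv D (A * B) = deriv D A * B + A * deriv D B :=
  deriv_mul_of_finite D A B (mul_support_finite_of_bddAboveDeg hA hB)
    (mul_support_finite_of_bddAboveDeg (hA.deriv D) hB)
    (mul_support_finite_of_bddAboveDeg hA (hB.deriv D))

theorem deriv_mul_of_bddBelowDeg {A B : DiffOp R} (hA : BddBelowDeg A) (hB : BddBelowDeg B) :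
    deriv D (A * B) = deriv D A * B + A * deriv D B :=
  deriv_mul_of_finite D A B (mul_support_finite_of_bddBelowDeg hA hB)
    (mul_support_finite_of_bddBelowDeg (hA.deriv D) hB)
    (mul_support_finite_of_bddBelowDeg hA (hB.deriv D))

theorem lax_conj_of_bddAboveDeg {P Q L B : DiffOp R} (hP : BddAboveDeg P) (hQ : BddAboveDeg Q)
    (hLa : BddAboveDeg L) (hB : BddAboveDeg B) (hPQ : P * Q = 1) (hQP : Q * P = 1)
    (hL : deriv D L = comm B L) :
    deriv D (P * L * Q) = comm (deriv D P * Q + P * B * Q) (P * L * Q) :=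
  congrArg Subtype.val (lax_conj (A := AboveOp R) (fun x => ⟨deriv D x.1, x.2.deriv D⟩)
    (fun x y => Subtype.ext (deriv_mul_of_bddAboveDeg D x.2 y.2)) (P := ⟨P, hP⟩) (Q := ⟨Q, hQ⟩)
    (L := ⟨L, hLa⟩) (B := ⟨B, hB⟩) (Subtype.ext hPQ) (Subtype.ext hQP) (Subtype.ext hL))

theorem lax_conj_of_bddBelowDeg {P Q L B : DiffOp R} (hP : BddBelowDeg P) (hQ : BddBelowDeg Q)
    (hLb : BddBelowDeg L) (hB : BddBelowDeg B) (hPQ : P * Q = 1) (hQP : Q * P = 1)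
    (hL : deriv D L = comm B L) :
    deriv D (P * L * Q) = comm (deriv D P * Q + P * B * Q) (P * L * Q) :=
  congrArg Subtype.val (lax_conj (A := BelowOp R) (fun x => ⟨deriv D x.1, x.2.deriv D⟩)
    (fun x y => Subtype.ext (deriv_mul_of_bddBelowDeg D x.2 y.2)) (P := ⟨P, hP⟩) (Q := ⟨Q, hQ⟩)
    (L := ⟨L, hLb⟩) (B := ⟨B, hB⟩) (Subtype.ext hPQ) (Subtype.ext hQP) (Subtype.ext hL))

/-- Darboux transformations of Toda Lax pairs: `P₁` and `P₂` are gauge operators in `Λ⁻¹` and in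
`Λ` which transform the generators of each flow to the same operator. -/
theorem IsTodaLaxPair.conj {D₁ D₂ : ℕ → Derivation ℂ R R} {L₁ L₂ P₁ Q₁ P₂ Q₂ : DiffOp R}
    (hL : IsTodaLaxPair D₁ D₂ L₁ L₂) {a : ℤ} (hP₁ : DegLE a P₁) (hP₁' : ∀ s, P₁ a s = 1)
    (hQ₁ : DegLE (-a) Q₁) (hPQ₁ : P₁ * Q₁ = 1) (hQP₁ : Q₁ * P₁ = 1)
    (hP₂ : DegGE 0 P₂) (hQ₂ : DegGE 0 Q₂) (hPQ₂ : P₂ * Q₂ = 1) (hQP₂ : Q₂ * P₂ = 1)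
    (h₁ : ∀ p, 1 ≤ p → deriv (D₁ p) P₁ * Q₁ + P₁ * nonnegPart (L₁ ^ p) * Q₁ =
      deriv (D₁ p) P₂ * Q₂ + P₂ * nonnegPart (L₁ ^ p) * Q₂)
    (h₂ : ∀ p, 1 ≤ p → deriv (D₂ p) P₁ * Q₁ + P₁ * negPart (L₂ ^ p) * Q₁ =
      deriv (D₂ p) P₂ * Q₂ + P₂ * negPart (L₂ ^ p) * Q₂) :
    IsTodaLaxPair D₁ D₂ (P₁ * L₁ * Q₁) (P₂ * L₂ * Q₂) := by
  have hL₁ := hL.lax₁.bddAboveDeg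
  have hL₂ := hL.lax₂.bddBelowDeg
  -- Each generator has finitely many degrees, hence lies in both rings and can be conjugated in
  -- either.
  have hB₁ (p : ℕ) := (bddAboveDeg_pow hL₁ p).nonnegPart
  have hB₂ (p : ℕ) := (bddBelowDeg_pow hL₂ p).negPart
  have hB₁' (p : ℕ) := degGE_nonnegPart (L₁ ^ p)
  have hB₂' (p : ℕ) := degLE_negPart (L₂ ^ p)
  -- Monicity of `P₁` matters here: the derivative has degree at most `a - 1`, against `-a` for
  -- `Q₁`.
  have hd₁ (D : Derivation ℂ R R) : DegLE (-1) (deriv D P₁ * Q₁) :=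
    ((hP₁.deriv_of_monic D hP₁').mul hQ₁).mono (by omega)
  have hd₂ (D : Derivation ℂ R R) : DegGE 0 (deriv D P₂ * Q₂) := (hP₂.deriv D).mul hQ₂
  have hn₁ (p : ℕ) (hp : 1 ≤ p) : nonnegPart ((P₁ * L₁ * Q₁) ^ p) =
      deriv (D₁ p) P₁ * Q₁ + P₁ * nonnegPart (L₁ ^ p) * Q₁ := by
    refine nonnegPart_eq_of_eq_add
      (C := P₁ * negPart (L₁ ^ p) * Q₁ + -(deriv (D₁ p) P₁ * Q₁)) ?_ ?_ ?_
    · rw [conj_pow_of_bddAboveDeg hL₁ hP₁.bddAbove hQ₁.bddAbove hPQ₁ hQP₁]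
      conv_lhs => rw [← nonnegPart_add_negPart (L₁ ^ p)]
      rw [mul_add_of_bddAboveDeg hP₁.bddAbove (hB₁ p) (degLE_negPart _).bddAbove,
        add_mul_of_bddAboveDeg (hP₁.bddAbove.mul (hB₁ p))
          (hP₁.bddAbove.mul (degLE_negPart _).bddAbove) hQ₁.bddAbove]
      abel
    -- Nonnegativity of degrees is visible only in the expansion in `Λ`, so the generator is
    -- rewritten through `P₂`.
    · rw [h₁ p hp]
      exact (hd₂ _).add ((hP₂.mul (hB₁' p)).mul hQ₂)
    · refine DegLE.add (((hP₁.mul (degLE_negPart _)).mul hQ₁).mono (by omega)) fun i s hi => ?_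
      rw [neg_apply, hd₁ _ i s hi, neg_zero]
  have hn₂ (p : ℕ) (hp : 1 ≤ p) : negPart ((P₂ * L₂ * Q₂) ^ p) =
      deriv (D₂ p) P₂ * Q₂ + P₂ * negPart (L₂ ^ p) * Q₂ := by
    refine negPart_eq_of_eq_add
      (B := P₂ * nonnegPart (L₂ ^ p) * Q₂ + -(deriv (D₂ p) P₂ * Q₂)) ?_ ?_ ?_
    · rw [conj_pow_of_bddBelowDeg hL₂ hP₂.bddBelow hQ₂.bddBelow hPQ₂ hQP₂]
      conv_lhs => rw [← nonnegPart_add_negPart (L₂ ^ p)]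
      rw [mul_add_of_bddBelowDeg hP₂.bddBelow (degGE_nonnegPart _).bddBelow (hB₂ p),
        add_mul_of_bddBelowDeg (hP₂.bddBelow.mul (degGE_nonnegPart _).bddBelow)
          (hP₂.bddBelow.mul (hB₂ p)) hQ₂.bddBelow]
      abel
    · refine DegGE.add ((hP₂.mul (degGE_nonnegPart _)).mul hQ₂) fun i s hi => ?_
      rw [neg_apply, hd₂ _ i s hi, neg_zero]
    -- Dually, negativity of degrees is visible only through `P₁`.
    · rw [← h₂ p hp]
      exact (hd₁ _).add (((hP₁.mul (hB₂' p)).mul hQ₁).mono (by omega))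
  refine ⟨hL.lax₁.conj hP₁ hP₁' hQ₁.bddAbove hPQ₁ hQP₁, hL.lax₂.conj hP₂ hQ₂ hPQ₂ hQP₂,
    fun p hp => ?_, fun p hp => ?_, fun p hp => ?_, fun p hp => ?_⟩
  · rw [hn₁ p hp]
    exact lax_conj_of_bddAboveDeg _ hP₁.bddAbove hQ₁.bddAbove hL₁ (hB₁ p) hPQ₁ hQP₁ (hL.eq₁₁ p hp)
  · rw [hn₂ p hp, ← h₂ p hp]
    exact lax_conj_of_bddAboveDeg _ hP₁.bddAbove hQ₁.bddAbove hL₁ (hB₂' p).bddAbove hPQ₁ hQP₁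
      (hL.eq₂₁ p hp)
  · rw [hn₁ p hp, h₁ p hp]
    exact lax_conj_of_bddBelowDeg _ hP₂.bddBelow hQ₂.bddBelow hL₂ (hB₁' p).bddBelow hPQ₂ hQP₂
      (hL.eq₁₂ p hp)
  · rw [hn₂ p hp]
    exact lax_conj_of_bddBelowDeg _ hP₂.bddBelow hQ₂.bddBelow hL₂ (hB₂ p) hPQ₂ hQP₂ (hL.eq₂₂ p hp)

end Derivation

/-! ### The operators `T₊`, `T₋` and their inverses. -/

theorem ofFun_mul_apply (f : ℤ → R) (A : DiffOp R) (n s : ℤ) : (ofFun f * A) n s = f s * A n s := by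
  rw [mul_apply, finsum_eq_single _ 0]
  · simp [ofFun]
  · intro i hi
    simp [ofFun, hi]

theorem mul_ofFun_apply (A : DiffOp R) (f : ℤ → R) (n s : ℤ) :
    (A * ofFun f) n s = A n s * f (s + n) := by
  rw [mul_apply, finsum_eq_single _ n]
  · simp [ofFun]
  · intro i hi
    rw [ofFun, if_neg (by omega), mul_zero]

theorem Lam_one_sub_ofFun_mul_apply (u : ℤ → R) (B : DiffOp R) (n s : ℤ) :
    ((Lam R 1 - ofFun u) * B) n s = B (n - 1) (s + 1) - u s * B n s := by
  rw [mul_apply_eq_sum {0, 1}]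
  · simp [Lam, ofFun]
    ring
  · intro i hi
    simp only [Finset.mem_insert, Finset.mem_singleton, not_or] at hi
    simp [Lam, ofFun, hi]

theorem mul_Lam_one_sub_ofFun_apply (B : DiffOp R) (u : ℤ → R) (n s : ℤ) :
    (B * (Lam R 1 - ofFun u)) n s = B (n - 1) s - B n s * u (s + n) := by
  rw [mul_apply_eq_sum {n - 1, n}]
  · rw [Finset.sum_pair (by omega)]
    simp [Lam, ofFun]
    ring
  · intro i hi
    simp only [Finset.mem_insert, Finset.mem_singleton, not_or] at hi
    rw [sub_apply, Lam, ofFun, if_neg (by omega), if_neg (by omega), sub_zero, mul_zero]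

theorem unit_mul_inv_apply (q : (ℤ → R)ˣ) (s : ℤ) : q.1 s * q⁻¹.1 s = 1 := congrFun q.mul_inv s

theorem unit_inv_mul_apply (q : (ℤ → R)ˣ) (s : ℤ) : q⁻¹.1 s * q.1 s = 1 := congrFun q.inv_mul s

theorem shiftUnit_apply (n : ℤ) (q : (ℤ → R)ˣ) (s : ℤ) : (shiftUnit n q).1 s = q.1 (s + n) := rfl

/-- This normal form shows that `T₊(q)` is monic of degree one, and reduces products with it to
two-term formulas. -/
theorem TPlus_eq (q : (ℤ → R)ˣ) : TPlus q = Lam R 1 - ofFun fun s => q.1 (s + 1) * q⁻¹.1 s := by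
  refine DiffOp.ext fun i s => ?_
  rw [TPlus, mul_ofFun_apply, ofFun_mul_apply, Delta, sub_apply, sub_apply, one_apply,
    shiftUnit_apply, Lam, ofFun]
  rcases eq_or_ne i 0 with rfl | h₀
  · simp
  rcases eq_or_ne i 1 with rfl | h₁
  · simp [unit_mul_inv_apply]
  · simp [h₀, h₁]

theorem iotaMinusTPlusInv_apply (q : (ℤ → R)ˣ) (i s : ℤ) :
    iotaMinusTPlusInv q i s = q.1 s * (if i < 0 then 1 else 0) * q⁻¹.1 (s + i + 1) := by
  rw [iotaMinusTPlusInv, mul_ofFun_apply, ofFun_mul_apply]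
  rfl

theorem iotaPlusTPlusInv_apply (q : (ℤ → R)ˣ) (i s : ℤ) :
    iotaPlusTPlusInv q i s = q.1 s * (if 0 ≤ i then -1 else 0) * q⁻¹.1 (s + i + 1) := by
  rw [iotaPlusTPlusInv, mul_ofFun_apply, ofFun_mul_apply]
  rfl

/-- Any solution `e` of `e_{n - 1} - e_n = δ_{n, 0}` provides a right inverse of `T₊(q)`. -/
theorem TPlus_mul_eq_one (q : (ℤ → R)ˣ) {Q : DiffOp R} (e : ℤ → R)
    (hQ : ∀ i s, Q i s = q.1 s * e i * q⁻¹.1 (s + i + 1))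
    (he : ∀ n, e (n - 1) - e n = if n = 0 then 1 else 0) : TPlus q * Q = 1 := by
  refine DiffOp.ext fun n s => ?_
  rw [TPlus_eq, Lam_one_sub_ofFun_mul_apply, hQ, hQ, show s + 1 + (n - 1) + 1 = s + n + 1 by ring]
  calc _ = q.1 (s + 1) * q⁻¹.1 (s + n + 1) * (e (n - 1) - q⁻¹.1 s * q.1 s * e n) := by ring
    _ = (1 : DiffOp R) n s := by
      rw [unit_inv_mul_apply, one_mul, he, one_apply]
      split_ifs with h
      · rw [h, add_zero, unit_mul_inv_apply, mul_one]
      · rw [mul_zero]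

/-- Any solution `e` of `e_{n - 1} - e_n = δ_{n, 0}` provides a left inverse of `T₊(q)`. -/
theorem mul_TPlus_eq_one (q : (ℤ → R)ˣ) {Q : DiffOp R} (e : ℤ → R)
    (hQ : ∀ i s, Q i s = q.1 s * e i * q⁻¹.1 (s + i + 1))
    (he : ∀ n, e (n - 1) - e n = if n = 0 then 1 else 0) : Q * TPlus q = 1 := by
  refine DiffOp.ext fun n s => ?_
  rw [TPlus_eq, mul_Lam_one_sub_ofFun_apply, hQ, hQ, show s + (n - 1) + 1 = s + n by ring]
  calc _ = q.1 s * q⁻¹.1 (s + n) * (e (n - 1) - q⁻¹.1 (s + n + 1) * q.1 (s + n + 1) * e n) := by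
        ring
    _ = (1 : DiffOp R) n s := by
      rw [unit_inv_mul_apply, one_mul, he, one_apply]
      split_ifs with h
      · rw [h, add_zero, unit_mul_inv_apply, mul_one]
      · rw [mul_zero]

theorem iotaMinus_coeff_sub (n : ℤ) :
    ((if n - 1 < 0 then 1 else 0) - if n < 0 then 1 else 0 : R) = if n = 0 then 1 else 0 := by
  split_ifs <;> first | omega | simp

theorem iotaPlus_coeff_sub (n : ℤ) :
    ((if 0 ≤ n - 1 then -1 else 0) - if 0 ≤ n then -1 else 0 : R) = if n = 0 then 1 else 0 := by
  split_ifs <;> first | omega | simp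

theorem TPlus_mul_iotaMinus (q : (ℤ → R)ˣ) : TPlus q * iotaMinusTPlusInv q = 1 :=
  TPlus_mul_eq_one q _ (iotaMinusTPlusInv_apply q) iotaMinus_coeff_sub

theorem iotaMinus_mul_TPlus (q : (ℤ → R)ˣ) : iotaMinusTPlusInv q * TPlus q = 1 :=
  mul_TPlus_eq_one q _ (iotaMinusTPlusInv_apply q) iotaMinus_coeff_sub

theorem TPlus_mul_iotaPlus (q : (ℤ → R)ˣ) : TPlus q * iotaPlusTPlusInv q = 1 :=
  TPlus_mul_eq_one q _ (iotaPlusTPlusInv_apply q) iotaPlus_coeff_sub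

theorem iotaPlus_mul_TPlus (q : (ℤ → R)ˣ) : iotaPlusTPlusInv q * TPlus q = 1 :=
  mul_TPlus_eq_one q _ (iotaPlusTPlusInv_apply q) iotaPlus_coeff_sub

theorem shiftUnit_one_neg_one (q : (ℤ → R)ˣ) : shiftUnit 1 (shiftUnit (-1) q) = q :=
  Units.ext <| funext fun s => congrArg q.1 (add_neg_cancel_right s 1)

/-- With `q = Λ⁻¹(r)⁻¹` one has `Λ(q) = r⁻¹`, so the adjoint case reuses everything about `T₊`, with
the operator and its inverses exchanged. -/
theorem TMinusInv_eq (r : (ℤ → R)ˣ) : TMinusInv r = TPlus (shiftUnit (-1) r⁻¹) := by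
  rw [TPlus, shiftUnit_one_neg_one]
  rfl

theorem iotaMinusTMinus_eq (r : (ℤ → R)ˣ) :
    iotaMinusTMinus r = iotaMinusTPlusInv (shiftUnit (-1) r⁻¹) := by
  rw [iotaMinusTPlusInv, shiftUnit_one_neg_one, inv_inv]
  rfl

theorem iotaPlusTMinus_eq (r : (ℤ → R)ˣ) :
    iotaPlusTMinus r = iotaPlusTPlusInv (shiftUnit (-1) r⁻¹) := by
  rw [iotaPlusTPlusInv, shiftUnit_one_neg_one, inv_inv]
  rfl

theorem degLE_TPlus (q : (ℤ → R)ˣ) : DegLE 1 (TPlus q) := fun i s hi => by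
  rw [TPlus_eq, sub_apply, Lam, ofFun, if_neg (by omega), if_neg (by omega), sub_zero]

theorem degGE_TPlus (q : (ℤ → R)ˣ) : DegGE 0 (TPlus q) := fun i s hi => by
  rw [TPlus_eq, sub_apply, Lam, ofFun, if_neg (by omega), if_neg (by omega), sub_zero]

theorem TPlus_apply_one (q : (ℤ → R)ˣ) (s : ℤ) : TPlus q 1 s = 1 := by
  rw [TPlus_eq, sub_apply, Lam, ofFun, if_pos rfl, if_neg one_ne_zero, sub_zero]

theorem degLE_iotaMinusTPlusInv (q : (ℤ → R)ˣ) : DegLE (-1) (iotaMinusTPlusInv q) :=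
  fun i s hi => by rw [iotaMinusTPlusInv_apply, if_neg (by omega), mul_zero, zero_mul]

theorem degGE_iotaPlusTPlusInv (q : (ℤ → R)ˣ) : DegGE 0 (iotaPlusTPlusInv q) :=
  fun i s hi => by rw [iotaPlusTPlusInv_apply, if_neg (by omega), mul_zero, zero_mul]

theorem iotaMinusTPlusInv_apply_neg_one (q : (ℤ → R)ˣ) (s : ℤ) :
    iotaMinusTPlusInv q (-1) s = 1 := by
  rw [iotaMinusTPlusInv_apply, if_pos (by omega), mul_one, neg_add_cancel_right,
    unit_mul_inv_apply]

/-! ### When the two expansions agree. -/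

/-- The two expansions of `T₊(q)⁻¹` differ by `∑ i ∈ ℤ, q Λ ^ i Λ(q)⁻¹`. -/
theorem iotaMinusTPlusInv_sub_iotaPlusTPlusInv_apply (q : (ℤ → R)ˣ) (i s : ℤ) :
    iotaMinusTPlusInv q i s - iotaPlusTPlusInv q i s = q.1 s * q⁻¹.1 (s + i + 1) := by
  rw [iotaMinusTPlusInv_apply, iotaPlusTPlusInv_apply]
  split_ifs <;> first | omega | ring

theorem finite_coeff {A : DiffOp R} (hA : BddAboveDeg A) (hA' : BddBelowDeg A) (g : ℤ → ℤ)
    (f : ℤ → R) : (Function.support fun i => A i (g i) * f i).Finite := by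
  obtain ⟨N, hN⟩ := hA
  obtain ⟨M, hM⟩ := hA'
  refine (Set.finite_Icc M N).subset fun i hi => ?_
  by_contra h
  rw [Set.mem_Icc, not_and_or, not_le, not_le] at h
  rcases h with h | h
  · exact hi (by simp [hM i _ h])
  · exact hi (by simp [hN i _ h])

/-- The two expansions of `X T₊(q)⁻¹` agree if `X` annihilates `q`. -/
theorem mul_iotaMinus_eq_mul_iotaPlus (q : (ℤ → R)ˣ) {X : DiffOp R} (hX : BddAboveDeg X)
    (hX' : BddBelowDeg X) (h : ∀ s, act X q.1 s = 0) :
    X * iotaMinusTPlusInv q = X * iotaPlusTPlusInv q := by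
  refine DiffOp.ext fun n s => sub_eq_zero.1 ?_
  rw [mul_apply, mul_apply, ← finsum_sub_distrib (finite_coeff hX hX' _ _)
    (finite_coeff hX hX' _ _)]
  -- The factor `q⁻¹` is evaluated at a point independent of `i`, so it comes out of the sum and
  -- leaves `X(q)`.
  calc _ = ∑ᶠ i, X i s * q.1 (s + i) * q⁻¹.1 (s + n + 1) := finsum_congr fun i => by
        rw [← mul_sub, iotaMinusTPlusInv_sub_iotaPlusTPlusInv_apply, mul_assoc,
          show s + i + (n - i) + 1 = s + n + 1 by ring]
    _ = act X q.1 s * q⁻¹.1 (s + n + 1) := (finsum_mul' _ _ (finite_coeff hX hX' _ _)).symm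
    _ = 0 := by rw [h, zero_mul]

/-- The two expansions of `T₊(q)⁻¹ Y` agree if `Y*` annihilates `Λ(q)⁻¹`. -/
theorem iotaMinus_mul_eq_iotaPlus_mul (q : (ℤ → R)ˣ) {Y : DiffOp R} (hY : BddAboveDeg Y)
    (hY' : BddBelowDeg Y) (h : ∀ s, act (adj Y) (fun s => q⁻¹.1 (s + 1)) s = 0) :
    iotaMinusTPlusInv q * Y = iotaPlusTPlusInv q * Y := by
  have hfin (f : ℤ → R) (n s : ℤ) :
      (Function.support fun i => f i * Y (n - i) (s + i)).Finite := by
    refine ((finite_coeff hY hY' (fun i => s + (n - i)) fun i => f (n - i)).preimage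
      (f := fun i => n - i) sub_right_injective.injOn).subset fun i hi => ?_
    simpa [mul_comm] using hi
  refine DiffOp.ext fun n s => sub_eq_zero.1 ?_
  rw [mul_apply, mul_apply, ← finsum_sub_distrib (hfin _ n s) (hfin _ n s)]
  calc _ = ∑ᶠ i, q.1 s * (q⁻¹.1 (s + i + 1) * Y (n - i) (s + i)) := finsum_congr fun i => by
        rw [← sub_mul, iotaMinusTPlusInv_sub_iotaPlusTPlusInv_apply, mul_assoc]
    _ = q.1 s * ∑ᶠ i, q⁻¹.1 (s + i + 1) * Y (n - i) (s + i) :=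
        (mul_finsum' _ _ (hfin _ n s)).symm
    _ = q.1 s * act (adj Y) (fun s => q⁻¹.1 (s + 1)) (s + n) := by
        -- The substitution `i ↦ i - n` turns the coefficients of `Y` into those of its adjoint
        -- based at `s + n`.
        rw [act, ← finsum_comp_equiv (Equiv.subRight n) (f := fun i =>
          adj Y i (s + n) * q⁻¹.1 (s + n + i + 1))]
        congr 1
        refine finsum_congr fun i => ?_
        simp only [Equiv.subRight_apply, adj]
        rw [add_add_sub_cancel, neg_sub, mul_comm]
    _ = 0 := by rw [h, mul_zero]

/-! ### Actions and adjoints of products with a first-order factor. -/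

theorem act_add {A B : DiffOp R} (hA : BddAboveDeg A) (hA' : BddBelowDeg A) (hB : BddAboveDeg B)
    (hB' : BddBelowDeg B) (f : ℤ → R) (s : ℤ) : act (A + B) f s = act A f s + act B f s := by
  rw [act, act, act, ← finsum_add_distrib (finite_coeff hA hA' _ _) (finite_coeff hB hB' _ _)]
  exact finsum_congr fun i => add_mul _ _ _

theorem act_ofFun (u f : ℤ → R) (s : ℤ) : act (ofFun u) f s = u s * f s := by
  rw [act, finsum_eq_single _ 0]
  · simp [ofFun]
  · intro i hi
    simp [ofFun, hi]

theorem act_Lam_one_sub_ofFun_mul {B : DiffOp R} (hB : BddAboveDeg B) (hB' : BddBelowDeg B)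
    (u f : ℤ → R) (s : ℤ) :
    act ((Lam R 1 - ofFun u) * B) f s = act B f (s + 1) - u s * act B f s := by
  have h₁ := finite_coeff hB hB' (fun _ => s + 1) fun i => f (s + 1 + i)
  have h₂ := finite_coeff hB hB' (fun _ => s) fun i => f (s + i)
  rw [act, act, act, mul_finsum' _ _ h₂, ← finsum_comp_equiv (Equiv.subRight (1 : ℤ))
    (f := fun i => B i (s + 1) * f (s + 1 + i)), ← finsum_sub_distrib]
  · refine finsum_congr fun i => ?_
    rw [Lam_one_sub_ofFun_mul_apply, Equiv.subRight_apply, add_add_sub_cancel]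
    ring
  · exact h₁.preimage (f := Equiv.subRight (1 : ℤ)) (Equiv.injective _).injOn
  · exact h₂.subset fun i hi h => hi (by simp only [h, mul_zero])

theorem BddAboveDeg.adj {A : DiffOp R} (hA : BddAboveDeg A) : BddBelowDeg (adj A) := by
  obtain ⟨N, hN⟩ := hA
  exact ⟨-N, fun i s hi => hN _ _ (by omega)⟩

theorem BddBelowDeg.adj {A : DiffOp R} (hA : BddBelowDeg A) : BddAboveDeg (adj A) := by
  obtain ⟨N, hN⟩ := hA
  exact ⟨-N, fun i s hi => hN _ _ (by omega)⟩

theorem adj_mul_Lam_one_sub_ofFun_eq (B : DiffOp R) (u : ℤ → R) (i s : ℤ) :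
    adj (B * (Lam R 1 - ofFun u)) i s = adj B (i + 1) (s - 1) - u s * adj B i s := by
  simp only [adj]
  rw [mul_Lam_one_sub_ofFun_apply, add_neg_cancel_right, neg_add',
    show s - 1 + (i + 1) = s + i by ring, mul_comm (u s)]

/-- The adjoint reverses products, and `(Λ - u)* = Λ⁻¹ - u`. -/
theorem act_adj_mul_Lam_one_sub_ofFun {B : DiffOp R} (hB : BddAboveDeg B) (hB' : BddBelowDeg B)
    (u f : ℤ → R) (s : ℤ) : act (adj (B * (Lam R 1 - ofFun u))) f s =
      act (adj B) f (s - 1) - u s * act (adj B) f s := by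
  have h₁ := finite_coeff hB'.adj hB.adj (fun _ => s - 1) fun i => f (s - 1 + i)
  have h₂ := finite_coeff hB'.adj hB.adj (fun _ => s) fun i => f (s + i)
  rw [act, act, act, mul_finsum' _ _ h₂, ← finsum_comp_equiv (Equiv.addRight (1 : ℤ))
    (f := fun i => adj B i (s - 1) * f (s - 1 + i)), ← finsum_sub_distrib]
  · refine finsum_congr fun i => ?_
    simp only [Equiv.coe_addRight]
    rw [adj_mul_Lam_one_sub_ofFun_eq, show s - 1 + (i + 1) = s + i by ring]
    ring
  · exact h₁.preimage (f := Equiv.addRight (1 : ℤ)) (Equiv.injective _).injOn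
  · exact h₂.subset fun i hi h => hi (by simp only [h, mul_zero])

theorem adj_add (A B : DiffOp R) : adj (A + B) = adj A + adj B := rfl

theorem adj_ofFun (u : ℤ → R) : adj (ofFun u) = ofFun u := DiffOp.ext fun i s => by
  rw [adj, ofFun, ofFun]
  rcases eq_or_ne i 0 with rfl | h
  · simp
  · simp [h]

/-! ### Eigenfunctions make the transformed generators coincide. -/

variable [Algebra ℂ R] (D : Derivation ℂ R R)

theorem deriv_Lam_one_sub_ofFun (u : ℤ → R) :
    deriv D (Lam R 1 - ofFun u) = ofFun fun s => -D (u s) := DiffOp.ext fun i s => by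
  rw [deriv_apply, sub_apply, map_sub, Lam, ofFun, ofFun]
  split_ifs <;> simp

/-- If `B` generates the flow of `q`, then `T₊(q)` carries it to a difference operator. -/
theorem TPlus_gauge (q : (ℤ → R)ˣ) {B : DiffOp R} (hB : BddAboveDeg B) (hB' : BddBelowDeg B)
    (hq : ∀ s, D (q.1 s) = act B q.1 s) :
    deriv D (TPlus q) * iotaMinusTPlusInv q + TPlus q * B * iotaMinusTPlusInv q =
      deriv D (TPlus q) * iotaPlusTPlusInv q + TPlus q * B * iotaPlusTPlusInv q := by
  have hT := (degLE_TPlus q).bddAbove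
  have hT' := (degGE_TPlus q).bddBelow
  rw [← add_mul_of_bddAboveDeg (hT.deriv D) (hT.mul hB) (degLE_iotaMinusTPlusInv q).bddAbove,
    ← add_mul_of_bddBelowDeg (hT'.deriv D) (hT'.mul hB') (degGE_iotaPlusTPlusInv q).bddBelow]
  refine mul_iotaMinus_eq_mul_iotaPlus q ((hT.deriv D).add (hT.mul hB))
    ((hT'.deriv D).add (hT'.mul hB')) fun s => ?_
  rw [act_add (hT.deriv D) (hT'.deriv D) (hT.mul hB) (hT'.mul hB'), TPlus_eq,
    deriv_Lam_one_sub_ofFun, act_ofFun, act_Lam_one_sub_ofFun_mul hB hB', ← hq, ← hq]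
  -- This is `T₊(q)(q) = 0`; its derivative is the required vanishing.
  have h : q.1 (s + 1) = q.1 (s + 1) * q⁻¹.1 s * q.1 s := by
    rw [mul_assoc, unit_inv_mul_apply, mul_one]
  have h' := congrArg D h
  rw [D.leibniz, smul_eq_mul, smul_eq_mul] at h'
  rw [h']
  ring

/-- If `B` generates the flow of `r`, then `T₋(r)` carries it to a difference operator. -/
theorem TMinus_gauge (r : (ℤ → R)ˣ) {B : DiffOp R} (hB : BddAboveDeg B) (hB' : BddBelowDeg B)
    (hr : ∀ s, D (r.1 s) = -act (adj B) r.1 s) :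
    deriv D (iotaMinusTMinus r) * TMinusInv r + iotaMinusTMinus r * B * TMinusInv r =
      deriv D (iotaPlusTMinus r) * TMinusInv r + iotaPlusTMinus r * B * TMinusInv r := by
  rw [TMinusInv_eq, iotaMinusTMinus_eq, iotaPlusTMinus_eq]
  set q := shiftUnit (-1) r⁻¹ with hq
  have hT := (degLE_TPlus q).bddAbove
  have hT' := (degGE_TPlus q).bddBelow
  have hP := (degLE_iotaMinusTPlusInv q).bddAbove
  have hP' := (degGE_iotaPlusTPlusInv q).bddBelow
  have hD₁ : deriv D 1 = (0 : DiffOp R) := DiffOp.ext fun i s => by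
    rw [deriv_apply, one_apply]
    split_ifs <;> simp
  have hE : -deriv D (TPlus q) = ofFun fun s => D (q.1 (s + 1) * q⁻¹.1 s) := by
    rw [TPlus_eq, deriv_Lam_one_sub_ofFun]
    refine DiffOp.ext fun i s => ?_
    rw [neg_apply, ofFun, ofFun]
    split_ifs <;> simp
  have hE₁ := (hT.deriv D).neg
  have hE₂ := (hT'.deriv D).neg
  -- Differentiating `T⁻¹ T = 1` moves the derivative onto `T`, so that `T⁻¹` factors out on the
  -- left of the whole generator.
  have h₁ : deriv D (iotaMinusTPlusInv q) * TPlus q =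
      iotaMinusTPlusInv q * -deriv D (TPlus q) := by
    have h := deriv_mul_of_bddAboveDeg D hP hT
    rw [iotaMinus_mul_TPlus, hD₁] at h
    rw [eq_neg_of_add_eq_zero_left h.symm]
    refine neg_eq_of_add_eq_zero_right ?_
    rw [← mul_add_of_bddAboveDeg hP (hT.deriv D) hE₁, add_neg_cancel, mul_zero_diffOp]
  have h₂ : deriv D (iotaPlusTPlusInv q) * TPlus q =
      iotaPlusTPlusInv q * -deriv D (TPlus q) := by
    have h := deriv_mul_of_bddBelowDeg D hP' hT'
    rw [iotaPlus_mul_TPlus, hD₁] at h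
    rw [eq_neg_of_add_eq_zero_left h.symm]
    refine neg_eq_of_add_eq_zero_right ?_
    rw [← mul_add_of_bddBelowDeg hP' (hT'.deriv D) hE₂, add_neg_cancel, mul_zero_diffOp]
  rw [h₁, h₂, mul_assoc_of_bddAboveDeg hP hB hT, mul_assoc_of_bddBelowDeg hP' hB' hT',
    ← mul_add_of_bddAboveDeg hP hE₁ (hB.mul hT), ← mul_add_of_bddBelowDeg hP' hE₂ (hB'.mul hT')]
  refine iotaMinus_mul_eq_iotaPlus_mul q (hE₁.add (hB.mul hT)) (hE₂.add (hB'.mul hT')) fun s => ?_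
  have hqr : (fun s => q⁻¹.1 (s + 1)) = r.1 :=
    funext fun s => congrArg r.1 (add_neg_cancel_right s 1)
  have hqr₁ (s : ℤ) : q⁻¹.1 s = r.1 (s - 1) := rfl
  rw [hqr, adj_add, act_add hE₂.adj hE₁.adj (hB'.mul hT').adj (hB.mul hT).adj, hE, adj_ofFun,
    act_ofFun, TPlus_eq, act_adj_mul_Lam_one_sub_ofFun hB hB']
  -- This is `T₊(q)*(r) = 0`; differentiating it and inserting the flow of `r` gives the goal up to
  -- sign.
  have h : r.1 (s - 1) = q.1 (s + 1) * q⁻¹.1 s * r.1 s := by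
    have hr' : r.1 s = q⁻¹.1 (s + 1) := (congrFun hqr s).symm
    rw [mul_right_comm, hr', unit_mul_inv_apply, one_mul, hqr₁]
  have h' := congrArg D h
  rw [D.leibniz, smul_eq_mul, smul_eq_mul, hr, hr] at h'
  linear_combination -h'

end Toda

theorem mainTheorem2 {R : Type*} [CommRing R] [Algebra ℂ R] (D₁ D₂ : ℕ → Derivation ℂ R R)
    (L₁ L₂ : Toda.DiffOp R) (hL : Toda.IsTodaLaxPair D₁ D₂ L₁ L₂) :
    (∀ q : (ℤ → R)ˣ, Toda.IsEigenfunction D₁ D₂ L₁ L₂ (q : ℤ → R) →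
      (Toda.TPlus q * Toda.iotaMinusTPlusInv q = 1 ∧
        Toda.iotaMinusTPlusInv q * Toda.TPlus q = 1 ∧
        Toda.TPlus q * Toda.iotaPlusTPlusInv q = 1 ∧
        Toda.iotaPlusTPlusInv q * Toda.TPlus q = 1) ∧
      Toda.IsTodaLaxPair D₁ D₂
        (Toda.TPlus q * L₁ * Toda.iotaMinusTPlusInv q)
        (Toda.TPlus q * L₂ * Toda.iotaPlusTPlusInv q)) ∧
    (∀ r : (ℤ → R)ˣ, Toda.IsAdjointEigenfunction D₁ D₂ L₁ L₂ (r : ℤ → R) →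
      (Toda.iotaMinusTMinus r * Toda.TMinusInv r = 1 ∧
        Toda.TMinusInv r * Toda.iotaMinusTMinus r = 1 ∧
        Toda.iotaPlusTMinus r * Toda.TMinusInv r = 1 ∧
        Toda.TMinusInv r * Toda.iotaPlusTMinus r = 1) ∧
      Toda.IsTodaLaxPair D₁ D₂
        (Toda.iotaMinusTMinus r * L₁ * Toda.TMinusInv r)
        (Toda.iotaPlusTMinus r * L₂ * Toda.TMinusInv r)) := by
  open Toda in
  have hB₁ (p : ℕ) := (bddAboveDeg_pow hL.lax₁.bddAboveDeg p).nonnegPart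
  have hB₁' (p : ℕ) := (degGE_nonnegPart (L₁ ^ p)).bddBelow
  have hB₂ (p : ℕ) := (degLE_negPart (L₂ ^ p)).bddAbove
  have hB₂' (p : ℕ) := (bddBelowDeg_pow hL.lax₂.bddBelowDeg p).negPart
  refine ⟨fun q hq => ⟨⟨TPlus_mul_iotaMinus q, iotaMinus_mul_TPlus q, TPlus_mul_iotaPlus q,
    iotaPlus_mul_TPlus q⟩, ?_⟩, fun r hr => ?_⟩
  · exact hL.conj (degLE_TPlus q) (TPlus_apply_one q) (degLE_iotaMinusTPlusInv q)
      (TPlus_mul_iotaMinus q) (iotaMinus_mul_TPlus q) (degGE_TPlus q) (degGE_iotaPlusTPlusInv q)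
      (TPlus_mul_iotaPlus q) (iotaPlus_mul_TPlus q)
      (fun p hp => TPlus_gauge _ q (hB₁ p) (hB₁' p) fun s => (hq p hp s).1)
      (fun p hp => TPlus_gauge _ q (hB₂ p) (hB₂' p) fun s => (hq p hp s).2)
  · have h₁ (p : ℕ) (hp : 1 ≤ p) := TMinus_gauge _ r (hB₁ p) (hB₁' p) fun s => (hr p hp s).1
    have h₂ (p : ℕ) (hp : 1 ≤ p) := TMinus_gauge _ r (hB₂ p) (hB₂' p) fun s => (hr p hp s).2
    rw [TMinusInv_eq, iotaMinusTMinus_eq, iotaPlusTMinus_eq] at *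
    set q := shiftUnit (-1) r⁻¹
    -- The gauge operators are now the expansions of `T₊(q)⁻¹`; the one in `Λ⁻¹` is monic of degree
    -- `-1`.
    exact ⟨⟨iotaMinus_mul_TPlus q, TPlus_mul_iotaMinus q, iotaPlus_mul_TPlus q,
      TPlus_mul_iotaPlus q⟩, hL.conj (degLE_iotaMinusTPlusInv q)
      (iotaMinusTPlusInv_apply_neg_one q) (degLE_TPlus q) (iotaMinus_mul_TPlus q)
      (TPlus_mul_iotaMinus q) (degGE_iotaPlusTPlusInv q) (degGE_TPlus q) (iotaPlus_mul_TPlus q)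
      (TPlus_mul_iotaPlus q) h₁ h₂⟩
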